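/- Let $n,N$ be natural numbers with $2\le n\le N$ and let $z_1,\dots,z_N\in\mathbb{C}$ satisfy $|z_j|\le 1$ for all $j$. Put $\widetilde z=\frac1N\sum_{j=1}^N z_j$ and $$E_{[N],n}=\sum_{J\subseteq\{1,\dots,N\},\ |J|=n}\ \prod_{j\in J}z_j .$$ Let $$\kappa=\frac{1}{N-2}\max_{1\le u,v\le N,\ u\ne v}\ \sum_{j\in\{1,\dots,N\}\setminus\{u,v\}}|z_j|^2\quad\text{if } n\ge 3,\qquad \kappa=1\quad\text{if } n=2,$$ and for real $x_1,x_2$ let $$f_n(x_1,x_2)=\sum_{k=2}^n (k-1)\,x_1^{\,n-k}x_2^{\,k-2}\qquad(\text{with } 0^0=1).$$ Then $$\left|\frac{E_{[N],n}}{\binom{N}{n}}-\widetilde z^{\,n}\right|\le\frac{f_n(|\widetilde z|,\sqrt{\kappa})}{N(N-1)}\sum_{j=1}^N|z_j-\widetilde z|^2\le\frac{n(n-1)}{N(N-1)}\sum_{j=1}^N|z_j-\widetilde z|^2\ \min\left\{\frac12,\ \frac{1}{n(1-|\widetilde z|)}\right\},$$ where $\frac10=\infty$, so that the minimum equals $\frac12$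 if $|\widetilde z|=1$. -/

import Mathlib

noncomputable section

namespace SymmMeans

/-- `f_n(x₁, x₂) = ∑_{k=2}^n (k-1) x₁^{n-k} x₂^{k-2}` (with `0 ^ 0 = 1`). -/
def f (n : ℕ) (x₁ x₂ : ℝ) : ℝ :=
  ∑ k ∈ Finset.Icc 2 n, ((k : ℝ) - 1) * x₁ ^ (n - k) * x₂ ^ (k - 2)

/-- The arithmetic mean `z̃` of `z_1, …, z_N`. -/
def mean {N : ℕ} (z : Fin N → ℂ) : ℂ :=
  (1 / (N : ℂ)) * ∑ j, z j

/-- The elementary symmetric sum `E_{[N],n}`: the sum, over all `n`-element sets `J` of indices,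
of the products `∏_{j ∈ J} z_j`. -/
def E {N : ℕ} (n : ℕ) (z : Fin N → ℂ) : ℂ :=
  ∑ J ∈ (Finset.univ : Finset (Fin N)).powersetCard n, ∏ j ∈ J, z j

/-- The quantity `κ`. For `n ≥ 3` it is `1 / (N - 2)` times the maximum, over ordered pairs of
distinct indices `(u, v)`, of `∑_{j ∉ {u, v}} |z_j|²` (the supremum is over a finite set, which is
nonempty when `2 ≤ N`); otherwise `κ = 1`. -/
def kappa {N : ℕ} (n : ℕ) (z : Fin N → ℂ) : ℝ :=
  if 3 ≤ n then
    (1 / ((N : ℝ) - 2)) * ⨆ p : {p : Fin N × Fin N // p.1 ≠ p.2},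
      ∑ j ∈ Finset.univ \ {p.1.1, p.1.2}, ‖z j‖ ^ 2
  else 1

/-- `min {1/2, 1/(n (1 - x))}` with the convention `1/0 = ∞`, so that it is `1/2` at `x = 1`. -/
def minHalf (n : ℕ) (x : ℝ) : ℝ :=
  if x = 1 then 1 / 2 else min (1 / 2) (1 / ((n : ℝ) * (1 - x)))

end SymmMeans

end

/-! Write A_k for the k-th elementary symmetric mean. Summing (z_u - z_v)^2 times the degree-k
elementary symmetric sum of the other variables over ordered pairs gives a negative multiple of
A_{k+2} - z̃ A_{k+1} (`sum_sq_sub_mul_elemSymm`). Bounding the inner sums by powers of r = √κ turns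
this into a one-step estimate by the variance (`norm_mean_sub_le`). Telescoping A_n - z̃^n through
these steps produces exactly the recursion of `f` (`f_succ`). The bound on the inner sums is
Maclaurin's inequality followed by AM-QM; Maclaurin comes from the same identity, whose left side is
nonnegative for nonnegative reals. -/

namespace SymmMeans

open Finset

/-! ### Identities for elementary symmetric sums -/

section Algebra

variable {ι R : Type*} [CommRing R]

/-- The elementary symmetric sum of degree `k` of the family `z` over the finite set `s`. -/
def elemSymm (z : ι → R) (s : Finset ι) (k : ℕ) : R :=
  ∑ J ∈ s.powersetCard k, ∏ j ∈ J, z j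

@[simp] lemma elemSymm_zero (z : ι → R) (s : Finset ι) : elemSymm z s 0 = 1 := by
  simp [elemSymm]

lemma elemSymm_one (z : ι → R) (s : Finset ι) : elemSymm z s 1 = ∑ j ∈ s, z j := by
  simp [elemSymm, Finset.powersetCard_one]

variable [DecidableEq ι]

lemma elemSymm_succ_insert (z : ι → R) {s : Finset ι} {j : ι} (hj : j ∉ s) (k : ℕ) :
    elemSymm z (insert j s) (k + 1) = elemSymm z s (k + 1) + z j * elemSymm z s k := by
  unfold elemSymm
  have hnot : ∀ J ∈ s.powersetCard k, j ∉ J := fun J hJ hjJ =>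
    hj ((mem_powersetCard.1 hJ).1 hjJ)
  rw [powersetCard_succ_insert hj, sum_union, sum_image, mul_sum]
  · congr 1
    exact sum_congr rfl fun J hJ => prod_insert (hnot J hJ)
  · intro A hA B hB hAB
    rw [← erase_insert (hnot A hA), ← erase_insert (hnot B hB), hAB]
  · rw [disjoint_left]
    intro A hA hA'
    obtain ⟨B, -, rfl⟩ := mem_image.1 hA'
    exact hj ((mem_powersetCard.1 hA).1 (mem_insert_self j B))

lemma elemSymm_succ_erase (z : ι → R) {s : Finset ι} {j : ι} (hj : j ∈ s) (k : ℕ) :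
    elemSymm z s (k + 1) = elemSymm z (s.erase j) (k + 1) + z j * elemSymm z (s.erase j) k := by
  rw [← elemSymm_succ_insert z (notMem_erase j s), insert_erase hj]

/-- Double counting: a k-subset of `s` avoids exactly `s.card - k` elements. -/
lemma sum_elemSymm_erase (z : ι → R) (s : Finset ι) (k : ℕ) :
    ∑ j ∈ s, elemSymm z (s.erase j) k = ((s.card : R) - k) * elemSymm z s k := by
  unfold elemSymm
  rw [sum_comm' (t' := s.powersetCard k) (s' := fun J => s \ J), mul_sum]
  · refine sum_congr rfl fun J hJ => ?_
    obtain ⟨hJs, hJk⟩ := mem_powersetCard.1 hJ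
    rw [sum_const, nsmul_eq_mul, card_sdiff_of_subset hJs,
      Nat.cast_sub (card_le_card hJs), hJk]
  · intro j J
    simp only [mem_powersetCard, mem_sdiff, subset_erase]
    tauto

lemma sum_mul_elemSymm_erase (z : ι → R) (s : Finset ι) (k : ℕ) :
    ∑ j ∈ s, z j * elemSymm z (s.erase j) k = ((k : R) + 1) * elemSymm z s (k + 1) := by
  have h : ∑ j ∈ s, z j * elemSymm z (s.erase j) k
      = ∑ j ∈ s, (elemSymm z s (k + 1) - elemSymm z (s.erase j) (k + 1)) :=
    sum_congr rfl fun j hj => by rw [elemSymm_succ_erase z hj]; ring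
  rw [h, sum_sub_distrib, sum_elemSymm_erase, sum_const, nsmul_eq_mul]
  push_cast
  ring

lemma sum_sq_mul_elemSymm_erase (z : ι → R) (s : Finset ι) (k : ℕ) :
    ∑ j ∈ s, z j ^ 2 * elemSymm z (s.erase j) k
      = (∑ j ∈ s, z j) * elemSymm z s (k + 1) - ((k : R) + 2) * elemSymm z s (k + 2) := by
  have h : ∑ j ∈ s, z j ^ 2 * elemSymm z (s.erase j) k
      = ∑ j ∈ s, (z j * elemSymm z s (k + 1) - z j * elemSymm z (s.erase j) (k + 1)) :=
    sum_congr rfl fun j hj => by rw [elemSymm_succ_erase z hj]; ring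
  rw [h, sum_sub_distrib, sum_mul_elemSymm_erase, ← sum_mul]
  push_cast
  ring

/-- Expand the square and apply the three erasure identities twice: over `v` in `s.erase u`, then
over `u`. -/
lemma sum_sq_sub_mul_elemSymm (z : ι → R) (s : Finset ι) (k : ℕ) :
    ∑ u ∈ s, ∑ v ∈ s.erase u, (z u - z v) ^ 2 * elemSymm z ((s.erase u).erase v) k
      = 2 * ((s.card : R) - (k + 1)) * (∑ j ∈ s, z j) * elemSymm z s (k + 1)
        - 2 * ((k : R) + 2) * s.card * elemSymm z s (k + 2) := by
  have hu : ∀ u ∈ s,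
      ∑ v ∈ s.erase u, (z u - z v) ^ 2 * elemSymm z ((s.erase u).erase v) k
      = ((s.card : R) - 1 - k) * (z u ^ 2 * elemSymm z (s.erase u) k)
        + (∑ j ∈ s, z j) * elemSymm z (s.erase u) (k + 1)
        - (2 * (k + 1) + 1) * (z u * elemSymm z (s.erase u) (k + 1))
        - (k + 2) * elemSymm z (s.erase u) (k + 2) := by
    intro u hu
    have h : ∑ v ∈ s.erase u, (z u - z v) ^ 2 * elemSymm z ((s.erase u).erase v) k
        = z u ^ 2 * (∑ v ∈ s.erase u, elemSymm z ((s.erase u).erase v) k)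
          - 2 * z u * (∑ v ∈ s.erase u, z v * elemSymm z ((s.erase u).erase v) k)
          + ∑ v ∈ s.erase u, z v ^ 2 * elemSymm z ((s.erase u).erase v) k := by
      rw [mul_sum, mul_sum, ← sum_sub_distrib, ← sum_add_distrib]
      exact sum_congr rfl fun v _ => by ring
    have hcard : ((s.erase u).card : R) = s.card - 1 := by
      rw [← card_erase_add_one hu]; push_cast; ring
    rw [h, sum_elemSymm_erase, sum_mul_elemSymm_erase, sum_sq_mul_elemSymm_erase, hcard,
      ← add_sum_erase s z hu]
    ring
  rw [sum_congr rfl hu, sum_sub_distrib, sum_sub_distrib, sum_add_distrib, ← mul_sum, ← mul_sum,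
    ← mul_sum, ← mul_sum, sum_sq_mul_elemSymm_erase, sum_elemSymm_erase, sum_mul_elemSymm_erase,
    sum_elemSymm_erase]
  push_cast
  ring

end Algebra

/-! ### Maclaurin's inequality and its quadratic-mean form -/

section Bounds

variable {ι : Type*}

lemma elemSymm_nonneg {x : ι → ℝ} (hx : ∀ j, 0 ≤ x j) (s : Finset ι) (k : ℕ) :
    0 ≤ elemSymm x s k :=
  sum_nonneg fun _ _ => prod_nonneg fun j _ => hx j

lemma norm_elemSymm_le (z : ι → ℂ) (s : Finset ι) (k : ℕ) :
    ‖elemSymm z s k‖ ≤ elemSymm (fun j => ‖z j‖) s k := by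
  refine (norm_sum_le _ _).trans (sum_le_sum fun J _ => ?_)
  rw [norm_prod]

lemma choose_succ_cast (N k : ℕ) :
    (N.choose (k + 1) : ℝ) * (k + 1) = N.choose k * ((N : ℝ) - k) := by
  rcases le_or_gt k N with h | h
  · have := Nat.choose_succ_right_eq N k
    rw [← Nat.cast_sub h]
    exact_mod_cast this
  · rw [Nat.choose_eq_zero_of_lt h, Nat.choose_eq_zero_of_lt (h.trans (Nat.lt_succ_self k))]
    simp

lemma choose_add_two_cast {N : ℕ} (hN : 2 ≤ N) (k : ℕ) :
    (N.choose (k + 2) : ℝ) * (k + 2) * (k + 1)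
      = (N : ℝ) * ((N : ℝ) - 1) * (N - 2).choose k := by
  obtain ⟨M, rfl⟩ := Nat.exists_eq_add_of_le' hN
  have h₁ := Nat.add_one_mul_choose_eq (M + 1) (k + 1)
  have h₂ := Nat.add_one_mul_choose_eq M k
  have h₁' : ((M : ℝ) + 1 + 1) * (M + 1).choose (k + 1) = (M + 2).choose (k + 2) * (k + 1 + 1) := by
    exact_mod_cast h₁
  have h₂' : ((M : ℝ) + 1) * M.choose k = (M + 1).choose (k + 1) * (k + 1) := by
    exact_mod_cast h₂
  rw [Nat.add_sub_cancel]
  push_cast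
  linear_combination (-(k : ℝ) - 1) * h₁' - ((M : ℝ) + 2) * h₂'

variable [DecidableEq ι]

/-- Maclaurin's inequality between an elementary symmetric mean and the arithmetic mean. -/
lemma elemSymm_le_choose_mul_pow {x : ι → ℝ} (hx : ∀ j, 0 ≤ x j) {s : Finset ι} (hs : s.Nonempty)
    (k : ℕ) :
    elemSymm x s k ≤ s.card.choose k * ((∑ j ∈ s, x j) / s.card) ^ k := by
  have hc : (0 : ℝ) < s.card := by exact_mod_cast hs.card_pos
  have hS : 0 ≤ ∑ j ∈ s, x j := sum_nonneg fun j _ => hx j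
  induction k with
  | zero => simp
  | succ k ih =>
    rcases k with _ | k
    · rw [elemSymm_one]
      simp only [zero_add, Nat.choose_one_right, pow_one]
      rw [mul_div_cancel₀ _ hc.ne']
    -- The induction step multiplies by `s.card - (k + 1)`, which must be nonnegative.
    rcases lt_or_ge s.card (k + 1) with h | h
    · have h0 : elemSymm x s (k + 1 + 1) = 0 := by
        rw [elemSymm, powersetCard_eq_empty.2 (by omega), sum_empty]
      rw [h0]
      positivity
    have hid := sum_sq_sub_mul_elemSymm x s k
    have hpos : 0 ≤ ∑ u ∈ s, ∑ v ∈ s.erase u,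
        (x u - x v) ^ 2 * elemSymm x ((s.erase u).erase v) k :=
      sum_nonneg fun u _ => sum_nonneg fun v _ =>
        mul_nonneg (sq_nonneg _) (elemSymm_nonneg hx _ _)
    rw [hid] at hpos
    have hch := choose_succ_cast s.card (k + 1)
    have hsub : (0 : ℝ) ≤ (s.card : ℝ) - (k + 1) := by
      rw [sub_nonneg]; exact_mod_cast h
    have hm := mul_le_mul_of_nonneg_left ih (mul_nonneg hsub hS)
    push_cast at hch
    have hkey : ((k : ℝ) + 2) * s.card * elemSymm x s (k + 1 + 1)
        ≤ (k + 2) * s.card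
          * (s.card.choose (k + 1 + 1) * ((∑ j ∈ s, x j) / s.card) ^ (k + 1 + 1)) := by
      have he : ((k : ℝ) + 2) * s.card
          * (s.card.choose (k + 1 + 1) * ((∑ j ∈ s, x j) / s.card) ^ (k + 1 + 1))
          = ((s.card : ℝ) - (k + 1)) * (∑ j ∈ s, x j)
            * (s.card.choose (k + 1) * ((∑ j ∈ s, x j) / s.card) ^ (k + 1)) := by
        rw [pow_succ _ (k + 1)]
        have hd : (s.card : ℝ) * ((∑ j ∈ s, x j) / s.card) = ∑ j ∈ s, x j :=
          mul_div_cancel₀ _ hc.ne'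
        set q := (∑ j ∈ s, x j) / s.card
        rw [← hd]
        linear_combination s.card * q * q ^ (k + 1) * hch
      rw [he]
      linarith
    exact le_of_mul_le_mul_left hkey (by positivity)

/-- An elementary symmetric mean is bounded by the corresponding power of the quadratic mean. -/
lemma norm_elemSymm_le_sqrt (z : ι → ℂ) {s : Finset ι} (hs : s.Nonempty) (k : ℕ) :
    ‖elemSymm z s k‖ ≤ s.card.choose k * √((∑ j ∈ s, ‖z j‖ ^ 2) / s.card) ^ k := by
  refine (norm_elemSymm_le z s k).trans
    ((elemSymm_le_choose_mul_pow (fun j => norm_nonneg (z j)) hs k).trans ?_)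
  have hc : (0 : ℝ) < s.card := by exact_mod_cast hs.card_pos
  gcongr
  refine Real.le_sqrt_of_sq_le ?_
  rw [div_pow, div_le_div_iff₀ (by positivity) hc]
  have := sq_sum_le_card_mul_sum_sq (s := s) (f := fun j => ‖z j‖)
  calc _ ≤ (s.card * ∑ j ∈ s, ‖z j‖ ^ 2) * (s.card : ℝ) := by gcongr
    _ = _ := by ring

end Bounds

/-! ### Telescoping around the mean, and bounds on κ and `f` -/

section Mean

variable {N : ℕ}

lemma sum_eq_card_mul_mean (hN : N ≠ 0) (z : Fin N → ℂ) : ∑ j, z j = N * mean z := by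
  have : (N : ℂ) ≠ 0 := Nat.cast_ne_zero.2 hN
  rw [mean]
  field_simp

lemma sum_norm_sq_sub (hN : N ≠ 0) (z : Fin N → ℂ) :
    ∑ u, ∑ v ∈ univ.erase u, ‖z u - z v‖ ^ 2 = 2 * N * ∑ j, ‖z j - mean z‖ ^ 2 := by
  -- Differences survive centring, and the cross terms vanish since the `w j` sum to zero.
  set w : Fin N → ℂ := fun j => z j - mean z with hw
  have hw0 : ∑ j, w j = 0 := by
    simp [hw, sum_sub_distrib, sum_eq_card_mul_mean hN z]
  have h₁ : ∀ u, ∑ v ∈ univ.erase u, ‖z u - z v‖ ^ 2 = ∑ v, ‖w u - w v‖ ^ 2 := by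
    intro u
    rw [← add_sum_erase univ (fun v => ‖w u - w v‖ ^ 2) (mem_univ u)]
    simp [hw]
  have h₂ : ∀ u, ∑ v, ‖w u - w v‖ ^ 2 = N * ‖w u‖ ^ 2 + ∑ v, ‖w v‖ ^ 2 := by
    intro u
    have hin : ∑ v, inner ℝ (w u) (w v) = 0 := by rw [← inner_sum, hw0, inner_zero_right]
    simp_rw [norm_sub_sq_real]
    rw [sum_add_distrib, sum_sub_distrib, ← mul_sum, hin]
    simp
  rw [sum_congr rfl fun u _ => (h₁ u).trans (h₂ u), sum_add_distrib, ← mul_sum]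
  simp
  ring

lemma norm_mean_le_one (hN : N ≠ 0) {z : Fin N → ℂ} (hz : ∀ j, ‖z j‖ ≤ 1) : ‖mean z‖ ≤ 1 := by
  have h : ‖∑ j, z j‖ ≤ N := (norm_sum_le _ _).trans <|
    (sum_le_sum fun j _ => hz j).trans (by simp)
  rw [sum_eq_card_mul_mean hN, norm_mul, Complex.norm_natCast] at h
  have hN' : (0 : ℝ) < N := by exact_mod_cast Nat.pos_of_ne_zero hN
  exact le_of_mul_le_mul_left (by simpa using h) hN'

lemma norm_mean_sub_le {k : ℕ} {z : Fin N → ℂ} {r : ℝ} (hk : k + 2 ≤ N)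
    (hr : ∀ u v : Fin N, u ≠ v →
      ‖elemSymm z ((univ.erase u).erase v) k‖ ≤ (N - 2).choose k * r ^ k) :
    ‖1 / (N.choose (k + 2) : ℂ) * E (k + 2) z - mean z * (1 / (N.choose (k + 1) : ℂ) * E (k + 1) z)‖
      ≤ (k + 1) * r ^ k * ((∑ j, ‖z j - mean z‖ ^ 2) / ((N : ℝ) * ((N : ℝ) - 1))) := by
  have hN : N ≠ 0 := by omega
  have hid := sum_sq_sub_mul_elemSymm z univ k
  rw [sum_eq_card_mul_mean hN z, card_univ, Fintype.card_fin] at hid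
  have hc₁ : (0 : ℝ) < N.choose (k + 1) := by exact_mod_cast Nat.choose_pos (by omega)
  have hc₂ : (0 : ℝ) < N.choose (k + 2) := by exact_mod_cast Nat.choose_pos hk
  have hc₁' : (N.choose (k + 1) : ℂ) ≠ 0 := by exact_mod_cast hc₁.ne'
  have hc₂' : (N.choose (k + 2) : ℂ) ≠ 0 := by exact_mod_cast hc₂.ne'
  have hch : (N.choose (k + 2) : ℂ) * (k + 2) = N.choose (k + 1) * ((N : ℂ) - (k + 1)) := by
    have := choose_succ_cast N (k + 1)
    rw [add_assoc, one_add_one_eq_two] at this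
    push_cast at this
    have h' : (N.choose (k + 2) : ℝ) * (k + 2) = N.choose (k + 1) * ((N : ℝ) - (k + 1)) := by
      linear_combination this
    exact_mod_cast congrArg (Complex.ofReal) h'
  set A := 1 / (N.choose (k + 2) : ℂ) * E (k + 2) z with hA
  set B := 1 / (N.choose (k + 1) : ℂ) * E (k + 1) z with hB
  have hA' : elemSymm z univ (k + 2) = N.choose (k + 2) * A := by
    rw [hA, ← mul_assoc, mul_one_div_cancel hc₂', one_mul]; rfl
  have hB' : elemSymm z univ (k + 1) = N.choose (k + 1) * B := by
    rw [hB, ← mul_assoc, mul_one_div_cancel hc₁', one_mul]; rfl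
  rw [hA', hB'] at hid
  have hfac : ∑ u, ∑ v ∈ univ.erase u, (z u - z v) ^ 2 * elemSymm z ((univ.erase u).erase v) k
      = -((2 * ((k + 2 : ℕ) : ℂ) * N * N.choose (k + 2)) * (A - mean z * B)) := by
    rw [hid]
    push_cast
    linear_combination (-2 * N * mean z * B) * hch
  have hle : ‖∑ u, ∑ v ∈ univ.erase u,
      (z u - z v) ^ 2 * elemSymm z ((univ.erase u).erase v) k‖
      ≤ 2 * N * (∑ j, ‖z j - mean z‖ ^ 2) * ((N - 2).choose k * r ^ k) := by
    rw [← sum_norm_sq_sub hN, sum_mul]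
    refine (norm_sum_le _ _).trans (sum_le_sum fun u _ => ?_)
    rw [sum_mul]
    refine (norm_sum_le _ _).trans (sum_le_sum fun v hv => ?_)
    rw [norm_mul, norm_pow]
    exact mul_le_mul_of_nonneg_left (hr u v (ne_of_mem_erase hv).symm) (by positivity)
  rw [hfac, norm_neg, norm_mul, norm_mul, norm_mul, norm_mul] at hle
  simp only [Complex.norm_natCast, Complex.norm_ofNat] at hle
  have hN0 : (0 : ℝ) < N := by exact_mod_cast Nat.pos_of_ne_zero hN
  have hN1 : (0 : ℝ) < (N : ℝ) - 1 := by
    have : (2 : ℝ) ≤ N := by exact_mod_cast (by omega : 2 ≤ N)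
    linarith
  have hch2 := choose_add_two_cast (N := N) (by omega) k
  rw [← mul_div_assoc, le_div_iff₀ (mul_pos hN0 hN1)]
  have hpos : (0 : ℝ) < 2 * ((k + 2 : ℕ) : ℝ) * N * N.choose (k + 2) := by positivity
  refine le_of_mul_le_mul_left ?_ hpos
  calc _ = (2 * ((k + 2 : ℕ) : ℝ) * N * N.choose (k + 2) * ‖A - mean z * B‖)
        * (N * ((N : ℝ) - 1)) := by ring
    _ ≤ (2 * N * (∑ j, ‖z j - mean z‖ ^ 2) * ((N - 2).choose k * r ^ k))
        * (N * ((N : ℝ) - 1)) := mul_le_mul_of_nonneg_right hle (mul_pos hN0 hN1).le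
    _ = _ := by
      push_cast
      linear_combination (-2 * N * (∑ j, ‖z j - mean z‖ ^ 2) * r ^ k) * hch2

lemma f_succ {n : ℕ} (hn : 1 ≤ n) (x y : ℝ) :
    f (n + 1) x y = x * f n x y + n * y ^ (n - 1) := by
  unfold f
  rw [sum_Icc_succ_top (by omega), mul_sum]
  congr 1
  · refine sum_congr rfl fun k hk => ?_
    rw [Nat.sub_add_comm (mem_Icc.1 hk).2, pow_succ]
    ring
  · simp

/-- The radius `r` is kept abstract because `kappa` depends on `n`, while the induction needs one
radius for all degrees. -/
lemma norm_symmMean_sub_pow_le {z : Fin N → ℂ} {r : ℝ} {n : ℕ} (hn : 1 ≤ n) (hnN : n ≤ N)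
    (hr : ∀ k, k + 2 ≤ n → ∀ u v : Fin N, u ≠ v →
      ‖elemSymm z ((univ.erase u).erase v) k‖ ≤ (N - 2).choose k * r ^ k) :
    ‖1 / (N.choose n : ℂ) * E n z - mean z ^ n‖
      ≤ f n ‖mean z‖ r * ((∑ j, ‖z j - mean z‖ ^ 2) / ((N : ℝ) * ((N : ℝ) - 1))) := by
  induction n, hn using Nat.le_induction with
  | base =>
    have : E 1 z = ∑ j, z j := elemSymm_one z univ
    simp [f, this, mean]
  | succ n hn ih =>
    obtain ⟨k, rfl⟩ := Nat.exists_eq_add_of_le' hn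
    have h₁ := ih (by omega) fun k hk => hr k (by omega)
    have h₂ := norm_mean_sub_le (k := k) (by omega) (hr k (by omega))
    rw [f_succ hn]
    set T := (∑ j, ‖z j - mean z‖ ^ 2) / ((N : ℝ) * ((N : ℝ) - 1))
    set A := 1 / (N.choose (k + 1 + 1) : ℂ) * E (k + 1 + 1) z
    set B := 1 / (N.choose (k + 1) : ℂ) * E (k + 1) z
    calc ‖A - mean z ^ (k + 1 + 1)‖
        = ‖(A - mean z * B) + mean z * (B - mean z ^ (k + 1))‖ := by congr 1; ring
      _ ≤ ‖A - mean z * B‖ + ‖mean z‖ * ‖B - mean z ^ (k + 1)‖ := by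
        rw [← norm_mul]; exact norm_add_le _ _
      _ ≤ (k + 1) * r ^ k * T + ‖mean z‖ * (f (k + 1) ‖mean z‖ r * T) := by gcongr
      _ = _ := by push_cast; ring

lemma norm_elemSymm_le_kappa {n k : ℕ} (hnN : n ≤ N) (hk : k + 2 ≤ n) (z : Fin N → ℂ)
    {u v : Fin N} (huv : u ≠ v) :
    ‖elemSymm z ((univ.erase u).erase v) k‖ ≤ (N - 2).choose k * √(kappa n z) ^ k := by
  -- For `k = 0` the remaining index set may be empty; `k ≥ 1` forces `n ≥ 3`, the nontrivial branch
  -- of `kappa`.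
  rcases Nat.eq_zero_or_pos k with rfl | hk0
  · simp
  have hs : (univ \ {u, v} : Finset (Fin N)) = (univ.erase u).erase v := by
    ext j; simp [and_comm]
  have hcard : ((univ.erase u).erase v).card = N - 2 := by
    rw [card_erase_of_mem (by simp [huv.symm]), card_erase_of_mem (mem_univ u), card_univ,
      Fintype.card_fin]
    omega
  have hne : ((univ.erase u).erase v).Nonempty := card_pos.1 (by omega)
  have h := norm_elemSymm_le_sqrt z hne k
  rw [hcard] at h
  refine h.trans ?_
  gcongr
  have hN2 : ((N - 2 : ℕ) : ℝ) = (N : ℝ) - 2 := by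
    rw [Nat.cast_sub (by omega)]; norm_num
  rw [kappa, if_pos (by omega), one_div_mul_eq_div, ← hN2, ← hs]
  gcongr
  exact le_ciSup (f := fun p : {p : Fin N × Fin N // p.1 ≠ p.2} =>
    ∑ j ∈ univ \ {p.1.1, p.1.2}, ‖z j‖ ^ 2) (Set.finite_range _).bddAbove ⟨(u, v), huv⟩

lemma kappa_le_one {n : ℕ} (hnN : n ≤ N) {z : Fin N → ℂ} (hz : ∀ j, ‖z j‖ ≤ 1) :
    kappa n z ≤ 1 := by
  unfold kappa
  split_ifs with hn
  · have hN : (0 : ℝ) < (N : ℝ) - 2 := by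
      have : (3 : ℝ) ≤ N := by exact_mod_cast hn.trans hnN
      linarith
    rw [one_div_mul_eq_div, div_le_one hN]
    refine Real.iSup_le (fun p => ?_) hN.le
    have hcard : (univ \ {p.1.1, p.1.2} : Finset (Fin N)).card = N - 2 := by
      rw [card_sdiff_of_subset (subset_univ _), card_pair p.2, card_univ, Fintype.card_fin]
    calc _ ≤ ∑ j ∈ (univ \ {p.1.1, p.1.2} : Finset (Fin N)), (1 : ℝ) :=
          sum_le_sum fun j _ => pow_le_one₀ (norm_nonneg _) (hz j)
      _ = (N : ℝ) - 2 := by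
        rw [sum_const, hcard, nsmul_one, Nat.cast_sub (by omega)]; norm_num
  · exact le_rfl

lemma f_le_half {n : ℕ} (hn : 1 ≤ n) {x y : ℝ} (hx : 0 ≤ x) (hx1 : x ≤ 1) (hy : 0 ≤ y)
    (hy1 : y ≤ 1) : f n x y ≤ n * ((n : ℝ) - 1) * (1 / 2) := by
  induction n, hn using Nat.le_induction with
  | base => simp [f]
  | succ n hn ih =>
    have hn' : (1 : ℝ) ≤ n := by exact_mod_cast hn
    rw [f_succ hn]
    have h0 : (0 : ℝ) ≤ n * ((n : ℝ) - 1) * (1 / 2) := by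
      have : 0 ≤ (n : ℝ) - 1 := by linarith
      positivity
    have h₁ : x * f n x y ≤ n * ((n : ℝ) - 1) * (1 / 2) :=
      (mul_le_mul_of_nonneg_left ih hx).trans (mul_le_of_le_one_left h0 hx1)
    have h₂ : (n : ℝ) * y ^ (n - 1) ≤ n :=
      mul_le_of_le_one_right (by positivity) (pow_le_one₀ hy hy1)
    push_cast
    linarith

/-- By `f_succ`, the new value is at most the convex combination `x * n + (1 - x) * n`. -/
lemma one_sub_mul_f_le {n : ℕ} (hn : 1 ≤ n) {x y : ℝ} (hx : 0 ≤ x) (hx1 : x ≤ 1) (hy : 0 ≤ y)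
    (hy1 : y ≤ 1) : (1 - x) * f n x y ≤ (n : ℝ) - 1 := by
  induction n, hn using Nat.le_induction with
  | base => simp [f]
  | succ n hn ih =>
    have hn' : (1 : ℝ) ≤ n := by exact_mod_cast hn
    rw [f_succ hn]
    have h₁ : x * ((1 - x) * f n x y) ≤ x * n :=
      mul_le_mul_of_nonneg_left (by linarith) hx
    have h₂ : (1 - x) * (n * y ^ (n - 1)) ≤ (1 - x) * n :=
      mul_le_mul_of_nonneg_left (mul_le_of_le_one_right (by positivity) (pow_le_one₀ hy hy1))
        (by linarith)
    push_cast
    linarith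

lemma f_le_minHalf {n : ℕ} (hn : 1 ≤ n) {x y : ℝ} (hx : 0 ≤ x) (hx1 : x ≤ 1) (hy : 0 ≤ y)
    (hy1 : y ≤ 1) : f n x y ≤ n * ((n : ℝ) - 1) * minHalf n x := by
  have hhalf := f_le_half hn hx hx1 hy hy1
  unfold minHalf
  split_ifs with h
  · exact hhalf
  · have hn' : (1 : ℝ) ≤ n := by exact_mod_cast hn
    have hx' : 0 < 1 - x := sub_pos.2 (lt_of_le_of_ne hx1 h)
    rw [mul_min_of_nonneg _ _ (mul_nonneg (by linarith) (by linarith))]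
    refine le_min hhalf ?_
    rw [mul_one_div, mul_div_mul_left _ _ (by linarith), le_div_iff₀ hx', mul_comm]
    exact one_sub_mul_f_le hn hx hx1 hy hy1

end Mean

end SymmMeans

theorem mainTheorem9 (n N : ℕ) (hn : 2 ≤ n) (hnN : n ≤ N) (z : Fin N → ℂ)
    (hz : ∀ j, ‖z j‖ ≤ 1) :
    ‖(1 / (N.choose n : ℂ)) * SymmMeans.E n z - SymmMeans.mean z ^ n‖
        ≤ SymmMeans.f n ‖SymmMeans.mean z‖ (Real.sqrt (SymmMeans.kappa n z))
            / ((N : ℝ) * ((N : ℝ) - 1)) * ∑ j, ‖z j - SymmMeans.mean z‖ ^ 2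
    ∧ SymmMeans.f n ‖SymmMeans.mean z‖ (Real.sqrt (SymmMeans.kappa n z))
            / ((N : ℝ) * ((N : ℝ) - 1)) * ∑ j, ‖z j - SymmMeans.mean z‖ ^ 2
        ≤ ((n : ℝ) * ((n : ℝ) - 1)) / ((N : ℝ) * ((N : ℝ) - 1))
            * (∑ j, ‖z j - SymmMeans.mean z‖ ^ 2)
            * SymmMeans.minHalf n ‖SymmMeans.mean z‖ := by
  have hT : 0 ≤ (∑ j, ‖z j - SymmMeans.mean z‖ ^ 2) / ((N : ℝ) * ((N : ℝ) - 1)) := by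
    have hN : (2 : ℝ) ≤ N := by exact_mod_cast hn.trans hnN
    have hN1 : 0 ≤ (N : ℝ) - 1 := by linarith
    positivity
  rw [div_mul_eq_mul_div (SymmMeans.f _ _ _), mul_div_assoc (SymmMeans.f _ _ _)]
  refine ⟨SymmMeans.norm_symmMean_sub_pow_le (by omega) hnN fun k hk u v huv =>
    SymmMeans.norm_elemSymm_le_kappa hnN hk z huv, ?_⟩
  calc _ ≤ (n * ((n : ℝ) - 1) * SymmMeans.minHalf n ‖SymmMeans.mean z‖)
        * ((∑ j, ‖z j - SymmMeans.mean z‖ ^ 2) / ((N : ℝ) * ((N : ℝ) - 1))) :=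
        mul_le_mul_of_nonneg_right
          (SymmMeans.f_le_minHalf (by omega) (norm_nonneg _)
            (SymmMeans.norm_mean_le_one (by omega) hz) (Real.sqrt_nonneg _)
            (Real.sqrt_le_one.2 (SymmMeans.kappa_le_one hnN hz))) hT
    _ = _ := by ring
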